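/- Let $p$ be a prime number, let $X=\Omega_p$ be the additive topological group of $p$-adic numbers, and let $Y$ be its character group, i.e. the group of continuous homomorphisms $y$ from $X$ to the unit circle, $x\mapsto (x,y)$, with the compact-open topology. Let $\xi_1$ and $\xi_2$ be independent random variables with values in $X$ and distributions $\mu_1$ and $\mu_2$, and let $\widehat\mu_j(y)=\int_X (x,y)\,d\mu_j(x)$, $y\in Y$, be their characteristic functions. Let $\alpha$ be a topological automorphism of $X$ with $\alpha\neq -I$, where $I$ is the identity. Suppose that the conditional distribution of $L_2=\xi_1+\alpha\xi_2$ given $L_1=\xi_1+\xi_2$ is symmetric (that is, for almost every value of $L_1$ it is invariant under $x\mapsto -x$). Then either $\mu_1$ and $\mu_2$ are both degenerate (each is concentrated at one point), or there is a proper closed subgroup $M\subsetneq Y$ such that $\widehat\mu_1(y)=\widehat\mu_2(y)=0$ for all $y\in Y\setminus M$. -/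

import Mathlib

open MeasureTheory ProbabilityTheory

/-- The (Pontryagin) character group `Y = X^*` of an additive topological group `X`: all continuous
homomorphisms from `X` to the unit circle, with the compact-open topology. It is written
multiplicatively. -/
abbrev CharGroup (X : Type*) [AddCommGroup X] [TopologicalSpace X] : Type _ :=
  PontryaginDual (Multiplicative X)

/-- The characteristic function `y ↦ ∫ (x, y) dμ(x)` of a measure `μ` on `X`, defined on the
character group of `X`. -/
noncomputable def charFn {X : Type*} [AddCommGroup X] [TopologicalSpace X] [MeasurableSpace X]
    (μ : Measure X) (y : CharGroup X) : ℂ :=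
  ∫ x, ((y (Multiplicative.ofAdd x) : Circle) : ℂ) ∂μ

/-- A distribution is degenerate if it is concentrated at one point. -/
def IsDegenerate {X : Type*} [MeasurableSpace X] (μ : Measure X) : Prop :=
  ∃ x : X, μ = Measure.dirac x

/-- The conditional distribution of `L₂` given `L₁` is symmetric: for almost every value `x` of
`L₁`, the regular conditional distribution of `L₂` given `L₁ = x` is invariant under `z ↦ -z`. -/
def CondDistribSymmetric {Ω β X : Type*} [MeasurableSpace Ω] [MeasurableSpace β]
    [MeasurableSpace X] [StandardBorelSpace X] [AddCommGroup X]
    (L₂ : Ω → X) (L₁ : Ω → β) (P : Measure Ω) [IsFiniteMeasure P] : Prop :=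
  ∀ᵐ x ∂(P.map L₁),
    (condDistrib L₂ L₁ P x).map (fun z => -z) = condDistrib L₂ L₁ P x

/-! Every topological automorphism of `ℚ_[p]` is multiplication by some `a`. Symmetry says that
`(L₁, L₂)` and `(L₁, -L₂)` have the same law. Taking Fourier transforms along the orbit `t ↦ dilate
t y` of a character, and then moduli, gives `F (s + t) * G (s + a * t) = F (s - t) * G (s - a * t)`.

For `a ≠ 1` put `d = (1 + a) / (1 - a)`. Two substitutions give `F x = F (d x) G ((d - 1) x)` and `G
x = F ((d + 1) x) G (d x)`, so values in `[0, 1]` cannot decrease along certain dilations. A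
dilation of norm greater than one forces the value `1` everywhere, by continuity at `0`; a dilation
by a unit must preserve values, because powers of a unit return near `1` (`apply_unit_mul_le`).
Hence a nonzero value at `x` yields the value `1` at a fixed multiple of `x` (`exists_multiplier`).

If nonzero values occur outside the annihilator of every ball, then so do values of modulus one, and
these confine one measure to arbitrarily small balls; the equation then makes the other degenerate
too. Otherwise the annihilator of some ball serves as `M`. -/

open Filter Topology

namespace PadicHeyde

/-! ### The functional equation for moduli on the `p`-adic line -/

section Recurrence

variable {p : ℕ} [Fact p.Prime]

/-- A continuous function that does not decrease under multiplication by a `p`-adic unit is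
invariant under it. -/
theorem apply_unit_mul_le {h : ℚ_[p] → ℝ} (hc : Continuous h) {u : ℚ_[p]} (hu : ‖u‖ = 1)
    (hle : ∀ x, h x ≤ h (u * x)) (x : ℚ_[p]) : h (u * x) ≤ h x := by
  have hu0 : u ≠ 0 := norm_ne_zero_iff.1 (by rw [hu]; exact one_ne_zero)
  have hmono : ∀ n : ℕ, ∀ x, h x ≤ h (u ^ n * x) := by
    intro n
    induction n with
    | zero => intro x; simp
    | succ k ih =>
      intro x
      refine (ih x).trans ((hle _).trans_eq ?_)
      congr 1; ring
  obtain ⟨w, hw, φ, hφ, hlim⟩ := (isCompact_closedBall (0 : ℚ_[p]) 1).tendsto_subseq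
    (x := fun n : ℕ => u ^ n) (fun n => by simp [hu])
  have hw1 : ‖w‖ = 1 := by
    have h1 : Tendsto (fun n => ‖u ^ φ n‖) atTop (𝓝 ‖w‖) := hlim.norm
    simp only [norm_pow, hu, one_pow] at h1
    exact tendsto_nhds_unique h1 tendsto_const_nhds
  have hw0 : w ≠ 0 := norm_ne_zero_iff.1 (by rw [hw1]; exact one_ne_zero)
  -- Ratios of consecutive terms of the convergent subsequence are powers of `u` with exponent at
  -- least one, and they tend to `1`.
  have hratio : Tendsto (fun n => u ^ φ (n + 1) / u ^ φ n) atTop (𝓝 1) := by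
    have := (hlim.comp (tendsto_add_atTop_nat 1)).div hlim hw0
    rw [div_self hw0] at this
    exact this
  have hlim2 : Tendsto (fun n => h (u ^ φ (n + 1) / u ^ φ n * x)) atTop (𝓝 (h x)) := by
    have := (hc.tendsto (1 * x)).comp (hratio.mul_const x)
    rw [one_mul] at this
    exact this
  refine ge_of_tendsto' hlim2 fun n => ?_
  have hlt : φ n < φ (n + 1) := hφ (Nat.lt_succ_self n)
  obtain ⟨k, hk⟩ := Nat.exists_eq_add_of_lt hlt
  have : u ^ φ (n + 1) / u ^ φ n * x = u ^ k * (u * x) := by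
    rw [hk]; field_simp; ring
  rw [this]
  exact hmono k _

/-- The functional equation satisfied by the moduli of the characteristic functions of two
independent variables along the orbit of a character. -/
structure ModulusEquation (a : ℚ_[p]) (F G : ℚ_[p] → ℝ) : Prop where
  contF : Continuous F
  contG : Continuous G
  nonnegF : ∀ x, 0 ≤ F x
  nonnegG : ∀ x, 0 ≤ G x
  le_oneF : ∀ x, F x ≤ 1
  le_oneG : ∀ x, G x ≤ 1
  zeroF : F 0 = 1
  zeroG : G 0 = 1
  evenF : ∀ x, F (-x) = F x
  evenG : ∀ x, G (-x) = G x
  eqn : ∀ s t, F (s + t) * G (s + a * t) = F (s - t) * G (s - a * t)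

namespace ModulusEquation

variable {a : ℚ_[p]} {F G : ℚ_[p] → ℝ}

theorem right_eq_one (H : ModulusEquation a F G) (ha : a ≠ 0) (hF : ∀ x, F x = 1) (x : ℚ_[p]) :
    G x = 1 := by
  have h := H.eqn (x / 2) (x / (2 * a))
  have h1 : x / 2 + a * (x / (2 * a)) = x := by field_simp; ring
  have h2 : x / 2 - a * (x / (2 * a)) = 0 := by field_simp; ring
  rw [h1, h2, hF, hF, H.zeroG] at h
  linarith

theorem left_eq_one (H : ModulusEquation a F G) (hG : ∀ x, G x = 1) (x : ℚ_[p]) :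
    F x = 1 := by
  have h := H.eqn (x / 2) (x / 2)
  rw [hG, hG, add_halves, sub_self, H.zeroF] at h
  linarith

/-- The choice `s = a * t` kills the factor `G (s - a * t)`; `t` is scaled so that `s - t = -x`. -/
theorem left_split (H : ModulusEquation a F G) (ha : a ≠ 1) {d : ℚ_[p]}
    (hd : d = (1 + a) / (1 - a)) (x : ℚ_[p]) : F x = F (d * x) * G ((d - 1) * x) := by
  have ha' : 1 - a ≠ 0 := sub_ne_zero.2 ha.symm
  have h := H.eqn (a * (x / (1 - a))) (x / (1 - a))
  have h1 : a * (x / (1 - a)) + x / (1 - a) = d * x := by rw [hd]; field_simp; ring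
  have h2 : a * (x / (1 - a)) + a * (x / (1 - a)) = (d - 1) * x := by
    rw [hd]; field_simp; ring
  have h3 : a * (x / (1 - a)) - x / (1 - a) = -x := by field_simp; ring
  rw [h1, h2, h3, sub_self, H.zeroG, H.evenF, mul_one] at h
  exact h.symm

/-- Here `s = t` kills the factor `F (s - t)`, and the scale makes `s - a * t = x`. -/
theorem right_split (H : ModulusEquation a F G) (ha : a ≠ 1) {d : ℚ_[p]}
    (hd : d = (1 + a) / (1 - a)) (x : ℚ_[p]) : G x = F ((d + 1) * x) * G (d * x) := by
  have ha' : 1 - a ≠ 0 := sub_ne_zero.2 ha.symm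
  have h := H.eqn (x / (1 - a)) (x / (1 - a))
  have h1 : x / (1 - a) + x / (1 - a) = (d + 1) * x := by rw [hd]; field_simp; ring
  have h2 : x / (1 - a) + a * (x / (1 - a)) = d * x := by rw [hd]; field_simp
  have h3 : x / (1 - a) - a * (x / (1 - a)) = x := by field_simp
  rw [h1, h2, h3, sub_self, H.zeroF, one_mul] at h
  exact h.symm

/-- The points `d⁻¹ ^ n * x` tend to `0`, where `h` is `1`, and their values are bounded above by `h
x`. -/
theorem eq_one_of_le_dilation {h : ℚ_[p] → ℝ} (hc : Continuous h) (h0 : h 0 = 1)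
    (h1 : ∀ x, h x ≤ 1) {d : ℚ_[p]} (hd : 1 < ‖d‖) (hle : ∀ x, h x ≤ h (d * x)) (x : ℚ_[p]) :
    h x = 1 := by
  have hd0 : d ≠ 0 := norm_pos_iff.1 (zero_lt_one.trans hd)
  have hmono : ∀ n : ℕ, h (d⁻¹ ^ n * x) ≤ h x := by
    intro n
    induction n with
    | zero => simp
    | succ k ih =>
      refine (hle _).trans (le_of_eq_of_le ?_ ih)
      congr 1; rw [pow_succ]; field_simp
  have hlim : Tendsto (fun n : ℕ => h (d⁻¹ ^ n * x)) atTop (𝓝 1) := by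
    have h2 : Tendsto (fun n : ℕ => d⁻¹ ^ n) atTop (𝓝 0) :=
      tendsto_pow_atTop_nhds_zero_of_norm_lt_one (by rw [norm_inv]; exact inv_lt_one_of_one_lt₀ hd)
    have := (hc.tendsto (0 * x)).comp (h2.mul_const x)
    rw [zero_mul, h0] at this
    exact this
  exact le_antisymm (h1 x) (le_of_tendsto' hlim hmono)

theorem eq_one_of_le_mul {s t : ℝ} (hs : 0 < s) (ht : t ≤ 1) (h : s ≤ t * s) : t = 1 :=
  le_antisymm ht (by nlinarith)

theorem mul_le_left {s t : ℝ} (hs : 0 ≤ s) (ht : t ≤ 1) : s * t ≤ s :=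
  mul_le_of_le_one_right hs ht

/-- Wherever one of the functions does not vanish, one of them equals one at a fixed multiple of
the point. -/
theorem exists_multiplier (ha0 : a ≠ 0) (ha : a ≠ -1) :
    ∃ e e' : ℚ_[p], e ≠ 0 ∧ e' ≠ 0 ∧ ∀ F G : ℚ_[p] → ℝ, ModulusEquation a F G → ∀ x,
      (F x ≠ 0 → F (e * x) = 1 ∨ G (e * x) = 1) ∧
      (G x ≠ 0 → F (e' * x) = 1 ∨ G (e' * x) = 1) := by
  rcases eq_or_ne a 1 with rfl | ha1
  -- For `a = 1` the quotient `d` is unavailable, but `s = t = x / 2` gives `F x * G x = 1`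
  -- directly.
  · refine ⟨1, 1, one_ne_zero, one_ne_zero, fun F G H x => ?_⟩
    have h := H.eqn (x / 2) (x / 2)
    rw [one_mul, add_halves, sub_self, H.zeroF, H.zeroG] at h
    have hF : F x = 1 := le_antisymm (H.le_oneF x) (by
      nlinarith [H.nonnegF x, H.nonnegG x, H.le_oneG x])
    simp [hF]
  have ha' : 1 - a ≠ 0 := sub_ne_zero.2 ha1.symm
  have ha'' : 1 + a ≠ 0 := fun h => ha (by linear_combination h)
  obtain ⟨d, hd⟩ : ∃ d, d = (1 + a) / (1 - a) := ⟨_, rfl⟩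
  -- This is where `a ≠ -1` enters: `d` is the multiplier when `‖d‖ < 1`, and for `d = 0` the
  -- conclusion would say nothing.
  have hd0 : d ≠ 0 := by rw [hd]; exact div_ne_zero ha'' ha'
  have hdm : d - 1 ≠ 0 := by
    have : d - 1 = 2 * a / (1 - a) := by rw [hd]; field_simp; ring
    rw [this]; exact div_ne_zero (mul_ne_zero two_ne_zero ha0) ha'
  have hdp : d + 1 ≠ 0 := by
    have : d + 1 = 2 / (1 - a) := by rw [hd]; field_simp; ring
    rw [this]; exact div_ne_zero two_ne_zero ha'
  have leF : ∀ F G, ModulusEquation a F G → ∀ x, F x ≤ F (d * x) := fun F G H x => by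
    rw [H.left_split ha1 hd x]; exact mul_le_left (H.nonnegF _) (H.le_oneG _)
  have leG : ∀ F G, ModulusEquation a F G → ∀ x, G x ≤ G (d * x) := fun F G H x => by
    rw [H.right_split ha1 hd x, mul_comm]; exact mul_le_left (H.nonnegG _) (H.le_oneF _)
  rcases lt_trichotomy ‖d‖ 1 with hlt | heq | hgt
  -- For `‖d‖ < 1` both `d + 1` and `d - 1` are units. Passing from `F` to `G` and back dilates by
  -- their product, so the inequalities are equalities, and the splitting leaves `F (d * x) = 1` or
  -- `G (d * x) = 1`.
  · have leFG : ∀ F G, ModulusEquation a F G → ∀ x, F x ≤ G ((d - 1) * x) := fun F G H x => by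
      rw [H.left_split ha1 hd x, mul_comm]; exact mul_le_left (H.nonnegG _) (H.le_oneF _)
    have leGF : ∀ F G, ModulusEquation a F G → ∀ x, G x ≤ F ((d + 1) * x) := fun F G H x => by
      rw [H.right_split ha1 hd x]; exact mul_le_left (H.nonnegF _) (H.le_oneG _)
    have hu : ‖(d + 1) * (d - 1)‖ = 1 := by
      have h1 : ‖d + 1‖ = 1 := by
        rw [Padic.add_eq_max_of_ne (by rw [norm_one]; exact hlt.ne), norm_one,
          max_eq_right hlt.le]
      have h2 : ‖d - 1‖ = 1 := by
        rw [sub_eq_add_neg, Padic.add_eq_max_of_ne (by rw [norm_neg, norm_one]; exact hlt.ne),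
          norm_neg, norm_one, max_eq_right hlt.le]
      rw [norm_mul, h1, h2, one_mul]
    refine ⟨d, d, hd0, hd0, fun F G H x => ⟨fun hx => Or.inl ?_, fun hx => Or.inr ?_⟩⟩
    · have h1 : G ((d - 1) * x) ≤ F x := by
        refine (leGF F G H _).trans ?_
        rw [← mul_assoc]
        refine apply_unit_mul_le H.contF hu (fun x => ?_) x
        rw [mul_assoc]
        exact (leFG F G H x).trans (leGF F G H _)
      have hpos : 0 < G ((d - 1) * x) :=
        ((H.nonnegF x).lt_of_ne' hx).trans_le (leFG F G H x)
      refine eq_one_of_le_mul hpos (H.le_oneF _) ?_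
      rwa [← H.left_split ha1 hd x]
    · have h1 : F ((d + 1) * x) ≤ G x := by
        refine (leFG F G H _).trans ?_
        rw [← mul_assoc, mul_comm (d - 1)]
        refine apply_unit_mul_le H.contG hu (fun x => ?_) x
        rw [mul_comm (d + 1), mul_assoc]
        exact (leGF F G H x).trans (leFG F G H _)
      have hpos : 0 < F ((d + 1) * x) :=
        ((H.nonnegG x).lt_of_ne' hx).trans_le (leGF F G H x)
      refine eq_one_of_le_mul hpos (H.le_oneG _) ?_
      rwa [mul_comm (G _), ← H.right_split ha1 hd x]
  -- For `‖d‖ = 1` recurrence gives `F (d * x) = F x` and likewise for `G`, so the other factor in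
  -- each splitting is `1`.
  · refine ⟨d - 1, d + 1, hdm, hdp, fun F G H x => ⟨fun hx => Or.inr ?_, fun hx => Or.inl ?_⟩⟩
    · have h1 := apply_unit_mul_le H.contF heq (leF F G H) x
      have hpos := ((H.nonnegF x).lt_of_ne' hx).trans_le (leF F G H x)
      refine eq_one_of_le_mul hpos (H.le_oneG _) ?_
      rwa [mul_comm (G _), ← H.left_split ha1 hd x]
    · have h1 := apply_unit_mul_le H.contG heq (leG F G H) x
      have hpos := ((H.nonnegG x).lt_of_ne' hx).trans_le (leG F G H x)
      refine eq_one_of_le_mul hpos (H.le_oneF _) ?_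
      rwa [← H.right_split ha1 hd x]
  · refine ⟨1, 1, one_ne_zero, one_ne_zero, fun F G H x => ?_⟩
    have := eq_one_of_le_dilation H.contF H.zeroF H.le_oneF hgt (leF F G H) x
    simp [this]

end ModulusEquation

end Recurrence

/-! ### Characters of `ℚ_[p]` and annihilators of balls -/

section Characters

variable {p : ℕ} [Fact p.Prime]

/-- An additive map is `ℚ`-linear, and `ℚ` is dense in `ℚ_[p]`. -/
theorem apply_eq_mul_apply_one (α : ℚ_[p] ≃ₜ+ ℚ_[p]) (x : ℚ_[p]) : α x = α 1 * x := by
  have : (fun x => α x) = fun x => α 1 * x := by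
    refine (Padic.denseRange_ratCast p).equalizer (map_continuous α) (continuous_const_mul _) ?_
    funext q
    have := map_rat_smul α q (1 : ℚ_[p])
    simpa [Rat.smul_def, mul_comm] using this
  exact congrFun this x

open Multiplicative in
/-- The character `x ↦ (t * x, y)`. -/
noncomputable def dilate (t : ℚ_[p]) (y : CharGroup ℚ_[p]) : CharGroup ℚ_[p] :=
  PontryaginDual.map
    (⟨AddMonoidHom.toMultiplicative (AddMonoidHom.mulLeft t),
      continuous_ofAdd.comp ((continuous_const_mul t).comp continuous_toAdd)⟩ :
      Multiplicative ℚ_[p] →ₜ* Multiplicative ℚ_[p]) y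

theorem dilate_apply (t : ℚ_[p]) (y : CharGroup ℚ_[p]) (x : ℚ_[p]) :
    dilate t y (Multiplicative.ofAdd x) = y (Multiplicative.ofAdd (t * x)) := rfl

theorem dilate_add (s t : ℚ_[p]) (y : CharGroup ℚ_[p]) :
    dilate (s + t) y = dilate s y * dilate t y := by
  refine PontryaginDual.ext fun x => ?_
  change y (Multiplicative.ofAdd ((s + t) * x.toAdd)) =
    y (Multiplicative.ofAdd (s * x.toAdd)) * y (Multiplicative.ofAdd (t * x.toAdd))
  rw [add_mul, ofAdd_add, map_mul]

theorem dilate_one (y : CharGroup ℚ_[p]) : dilate 1 y = y := by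
  refine PontryaginDual.ext fun x => ?_
  change y (Multiplicative.ofAdd (1 * x.toAdd)) = y x
  rw [one_mul, ofAdd_toAdd]

theorem dilate_zero (y : CharGroup ℚ_[p]) : dilate 0 y = 1 := by
  refine PontryaginDual.ext fun x => ?_
  change y (Multiplicative.ofAdd (0 * x.toAdd)) = 1
  rw [zero_mul, ofAdd_zero, map_one]

theorem dilate_neg (t : ℚ_[p]) (y : CharGroup ℚ_[p]) : dilate (-t) y = (dilate t y)⁻¹ := by
  rw [eq_inv_iff_mul_eq_one, ← dilate_add, neg_add_cancel, dilate_zero]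

/-- The annihilator of the closed ball of radius `r` about the origin. -/
def ballAnnihilator (p : ℕ) [Fact p.Prime] (r : ℝ) : Subgroup (CharGroup ℚ_[p]) where
  carrier := {y | ∀ x : ℚ_[p], ‖x‖ ≤ r → y (Multiplicative.ofAdd x) = 1}
  mul_mem' {y z} hy hz x hx := by
    change y (Multiplicative.ofAdd x) * z (Multiplicative.ofAdd x) = 1
    rw [hy x hx, hz x hx, one_mul]
  one_mem' _ _ := rfl
  inv_mem' {y} hy x hx := by
    change (y (Multiplicative.ofAdd x))⁻¹ = 1
    rw [hy x hx, inv_one]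

theorem mem_ballAnnihilator {r : ℝ} {y : CharGroup ℚ_[p]} :
    y ∈ ballAnnihilator p r ↔ ∀ x : ℚ_[p], ‖x‖ ≤ r → y (Multiplicative.ofAdd x) = 1 := Iff.rfl

theorem continuous_eval (x : Multiplicative ℚ_[p]) :
    Continuous fun y : CharGroup ℚ_[p] => y x :=
  (ContinuousEvalConst.continuous_eval_const (F := Multiplicative ℚ_[p] →ₜ* Circle) x)

theorem isClosed_ballAnnihilator (r : ℝ) :
    IsClosed (ballAnnihilator p r : Set (CharGroup ℚ_[p])) := by
  have : (ballAnnihilator p r : Set (CharGroup ℚ_[p])) =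
      ⋂ (x : ℚ_[p]) (_ : ‖x‖ ≤ r), {y | y (Multiplicative.ofAdd x) = 1} := by
    ext y; simp [mem_ballAnnihilator]
  rw [this]
  exact isClosed_iInter fun x => isClosed_iInter fun _ =>
    isClosed_eq (continuous_eval _) continuous_const

theorem ballAnnihilator_anti {r s : ℝ} (h : r ≤ s) :
    ballAnnihilator p s ≤ ballAnnihilator p r :=
  fun _ hy x hx => hy x (hx.trans h)

theorem dilate_notMem {r : ℝ} {y : CharGroup ℚ_[p]} {e : ℚ_[p]} (he : e ≠ 0)
    (hy : y ∉ ballAnnihilator p (‖e‖ * r)) : dilate e y ∉ ballAnnihilator p r := by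
  intro h
  refine hy fun x hx => ?_
  have := h (e⁻¹ * x) (by
    rw [norm_mul, norm_inv, inv_mul_le_iff₀ (norm_pos_iff.2 he)]; exact hx)
  rwa [dilate_apply, mul_inv_cancel_left₀ he] at this

/-- The kernel of `y` is a closed subgroup, hence stable under `ℤ_[p]`. If it contained `z` with `r
≤ ‖z‖`, it would contain the whole ball of radius `r`. -/
theorem norm_lt_of_apply_eq_one {r : ℝ} {y : CharGroup ℚ_[p]} (hy : y ∉ ballAnnihilator p r)
    {z : ℚ_[p]} (hz : y (Multiplicative.ofAdd z) = 1) : ‖z‖ < r := by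
  by_contra! hle
  refine hy fun w hw => ?_
  rcases eq_or_ne z 0 with rfl | hz0
  · have : w = 0 := norm_le_zero_iff.1 (by rw [norm_zero] at hle; exact hw.trans hle)
    rwa [this]
  have hnorm : ‖w / z‖ ≤ 1 := by
    rw [norm_div, div_le_one (norm_pos_iff.2 hz0)]; exact hw.trans hle
  have key : (fun t : ℤ_[p] => y (Multiplicative.ofAdd ((t : ℚ_[p]) * z))) = fun _ => 1 := by
    refine PadicInt.denseRange_natCast.equalizer ?_ continuous_const ?_
    · exact (map_continuous y).comp
        (continuous_ofAdd.comp (PadicInt.isOpenEmbedding_coe.continuous.mul continuous_const))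
    · funext n
      simp only [Function.comp_apply, PadicInt.coe_natCast]
      rw [← nsmul_eq_mul, ofAdd_nsmul, map_pow, hz, one_pow]
  have := congrFun key ⟨w / z, hnorm⟩
  simpa [div_mul_cancel₀ _ hz0] using this

/-- The nonzero class of `1 / p` modulo the `p`-adic integers is detected by a homomorphism to `ℚ /
ℤ`, which embeds in the circle. The resulting character is trivial on the unit ball, hence
continuous. -/
theorem exists_ne_one : ∃ y : CharGroup ℚ_[p], y ≠ 1 := by
  let Z : AddSubgroup ℚ_[p] := (PadicInt.subring p).toAddSubgroup
  have hZ : ∀ x : ℚ_[p], x ∈ Z ↔ ‖x‖ ≤ 1 := fun x => Iff.rfl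
  have hp : ((p : ℚ_[p])⁻¹ : ℚ_[p]) ∉ Z := by
    rw [hZ, norm_inv, Padic.norm_p, inv_inv, not_le]
    exact_mod_cast (Fact.out : p.Prime).one_lt
  obtain ⟨c, hc⟩ := CharacterModule.exists_character_apply_ne_zero_of_ne_zero
    (a := (QuotientAddGroup.mk ((p : ℚ_[p])⁻¹) : ℚ_[p] ⧸ Z))
    (fun h => hp ((QuotientAddGroup.eq_zero_iff _).1 h))
  let ι : AddCircle (1 : ℚ) →+ AddCircle (1 : ℝ) :=
    QuotientAddGroup.map _ _ (Rat.castHom ℝ).toAddMonoidHom (by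
      rw [AddSubgroup.zmultiples_le]
      exact ⟨1, by simp⟩)
  have hι : Function.Injective ι := by
    rw [injective_iff_map_eq_zero]
    intro b
    induction b using QuotientAddGroup.induction_on with
    | H q =>
      intro hq
      obtain ⟨n, hn⟩ := (QuotientAddGroup.eq_zero_iff ((q : ℚ) : ℝ)).1 hq
      refine (QuotientAddGroup.eq_zero_iff q).2 ⟨n, ?_⟩
      simp only [zsmul_eq_mul, mul_one] at hn ⊢
      exact_mod_cast hn
  let c' : ℚ_[p] ⧸ Z →+ AddCircle (1 : ℚ) := c
  let χ : AddChar ℚ_[p] Circle := AddCircle.toCircle_addChar.compAddMonoidHom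
    ((ι.comp c').comp (QuotientAddGroup.mk' Z))
  have hχ : ∀ x, χ x = AddCircle.toCircle (ι (c' (QuotientAddGroup.mk x))) := fun x => rfl
  have hχc : Continuous χ.toMonoidHom := by
    refine continuous_of_continuousAt_one _ ?_
    refine ContinuousAt.congr (f := fun _ => (1 : Circle)) continuousAt_const ?_
    have : Metric.ball (0 : ℚ_[p]) 1 ∈ 𝓝 (0 : ℚ_[p]) := Metric.ball_mem_nhds _ one_pos
    have h' : ∀ᶠ x in 𝓝 (1 : Multiplicative ℚ_[p]), x.toAdd ∈ Metric.ball (0 : ℚ_[p]) 1 :=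
      continuous_toAdd.continuousAt.eventually this
    filter_upwards [h'] with x hx
    have hx' : x.toAdd ∈ Z := (hZ _).2 (mem_ball_zero_iff.1 hx).le
    change 1 = χ x.toAdd
    rw [hχ, (QuotientAddGroup.eq_zero_iff _).2 hx', map_zero, map_zero, AddCircle.toCircle_zero]
  refine ⟨(⟨χ.toMonoidHom, hχc⟩ : Multiplicative ℚ_[p] →ₜ* Circle), fun h => hc ?_⟩
  have h1 : χ ((p : ℚ_[p])⁻¹) = 1 := DFunLike.congr_fun h (Multiplicative.ofAdd ((p : ℚ_[p])⁻¹))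
  rw [hχ, ← AddCircle.toCircle_zero (T := 1)] at h1
  have h2 := AddCircle.injective_toCircle one_ne_zero h1
  exact hι (h2.trans (map_zero ι).symm)

theorem exists_notMem_ballAnnihilator {r : ℝ} (hr : 0 < r) :
    ∃ y : CharGroup ℚ_[p], y ∉ ballAnnihilator p r := by
  obtain ⟨y, hy⟩ := exists_ne_one (p := p)
  obtain ⟨x, hx⟩ : ∃ x : ℚ_[p], y (Multiplicative.ofAdd x) ≠ 1 := by
    by_contra! h
    exact hy (PontryaginDual.ext fun x => h x.toAdd)
  have hx0 : x ≠ 0 := by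
    rintro rfl
    exact hx (by rw [ofAdd_zero, map_one])
  obtain ⟨t, ht0, ht⟩ := NormedField.exists_norm_lt ℚ_[p] (div_pos hr (norm_pos_iff.2 hx0))
  have ht0' : t ≠ 0 := norm_pos_iff.1 ht0
  refine ⟨dilate t⁻¹ y, fun h => hx ?_⟩
  have := h (t * x) (by
    rw [norm_mul]; exact ((lt_div_iff₀ (norm_pos_iff.2 hx0)).1 ht).le)
  rwa [dilate_apply, inv_mul_cancel_left₀ ht0'] at this

theorem ballAnnihilator_ne_top {r : ℝ} (hr : 0 < r) : ballAnnihilator p r ≠ ⊤ := by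
  intro h
  obtain ⟨y, hy⟩ := exists_notMem_ballAnnihilator (p := p) hr
  exact hy (h ▸ Subgroup.mem_top y)

end Characters

/-! ### Characteristic functions and degeneracy -/

section CharacteristicFunctions

variable {p : ℕ} [Fact p.Prime]

theorem continuous_character (y : CharGroup ℚ_[p]) :
    Continuous fun x : ℚ_[p] => ((y (Multiplicative.ofAdd x) : Circle) : ℂ) :=
  continuous_subtype_val.comp ((map_continuous y).comp continuous_ofAdd)

variable [MeasurableSpace ℚ_[p]]

theorem charFn_one (μ : Measure ℚ_[p]) [IsProbabilityMeasure μ] : charFn μ 1 = 1 := by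
  simp [charFn]

theorem norm_charFn_le_one (μ : Measure ℚ_[p]) [IsProbabilityMeasure μ] (y : CharGroup ℚ_[p]) :
    ‖charFn μ y‖ ≤ 1 := by
  refine (norm_integral_le_of_norm_le_const (C := 1)
    (Eventually.of_forall fun x => (Circle.norm_coe _).le)).trans ?_
  simp

theorem norm_charFn_inv (μ : Measure ℚ_[p]) (y : CharGroup ℚ_[p]) :
    ‖charFn μ y⁻¹‖ = ‖charFn μ y‖ := by
  have : charFn μ y⁻¹ = (starRingEnd ℂ) (charFn μ y) := by
    unfold charFn
    rw [← integral_conj]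
    congr 1
    funext x
    rw [← Circle.coe_inv_eq_conj]
    rfl
  rw [this, RCLike.norm_conj]

/-- Equality in the triangle inequality makes each `y n` almost everywhere constant. Two typical
points then differ by an element of every kernel, and `norm_lt_of_apply_eq_one` makes that
difference arbitrarily small. -/
theorem isDegenerate_of_norm_charFn {μ : Measure ℚ_[p]} [IsProbabilityMeasure μ]
    (h : ∀ r : ℝ, 0 < r → ∃ y ∉ ballAnnihilator p r, ‖charFn μ y‖ = 1) : IsDegenerate μ := by
  have hn : ∀ n : ℕ, (0 : ℝ) < 1 / ((n : ℝ) + 1) := fun n => Nat.one_div_pos_of_nat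
  choose y hy hy1 using fun n : ℕ => h _ (hn n)
  have hconst : ∀ᵐ x ∂μ, ∀ n,
      ((y n (Multiplicative.ofAdd x) : Circle) : ℂ) = charFn μ (y n) := by
    rw [ae_all_iff]
    intro n
    rcases ae_eq_const_or_norm_integral_lt_of_norm_le_const (μ := μ) (C := 1)
      (f := fun x => ((y n (Multiplicative.ofAdd x) : Circle) : ℂ))
      (Eventually.of_forall fun x => (Circle.norm_coe _).le) with h1 | h1
    · filter_upwards [h1] with x hx
      rw [hx, Function.const_apply, average_eq_integral]
      rfl
    · have h2 := hy1 n
      simp only [probReal_univ, one_mul] at h1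
      exact absurd h2 h1.ne
  obtain ⟨x₀, hx₀⟩ := hconst.exists
  refine ⟨x₀, ?_⟩
  have hae : (fun x => x) =ᵐ[μ] fun _ => x₀ := by
    filter_upwards [hconst] with x hx
    rw [← sub_eq_zero, ← norm_le_zero_iff]
    refine ge_of_tendsto' tendsto_one_div_add_atTop_nhds_zero_nat fun n => ?_
    refine (norm_lt_of_apply_eq_one (hy n) ?_).le
    have : y n (Multiplicative.ofAdd x) = y n (Multiplicative.ofAdd x₀) :=
      Circle.ext ((hx n).trans (hx₀ n).symm)
    rw [ofAdd_sub, map_div, this, div_self']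
  calc μ = μ.map (fun x => x) := Measure.map_id'.symm
    _ = μ.map (fun _ => x₀) := Measure.map_congr hae
    _ = Measure.dirac x₀ := by rw [Measure.map_const]; simp

variable [BorelSpace ℚ_[p]]

theorem continuous_charFn_dilate (μ : Measure ℚ_[p]) [IsProbabilityMeasure μ]
    (y : CharGroup ℚ_[p]) : Continuous fun t : ℚ_[p] => charFn μ (dilate t y) := by
  refine continuous_of_dominated (bound := fun _ => 1) (fun t => ?_) (fun t => ?_)
    (integrable_const _) (Eventually.of_forall fun x => ?_)
  · exact (continuous_character _).aestronglyMeasurable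
  · exact Eventually.of_forall fun x => (Circle.norm_coe _).le
  · exact (continuous_character y).comp (continuous_mul_const x)

theorem norm_charFn_dirac (x : ℚ_[p]) (y : CharGroup ℚ_[p]) :
    ‖charFn (Measure.dirac x) y‖ = 1 := by
  rw [charFn, integral_dirac]
  exact Circle.norm_coe _

end CharacteristicFunctions

/-! ### From conditional symmetry to degeneracy -/

section Heyde

variable {p : ℕ} [Fact p.Prime] [MeasurableSpace ℚ_[p]] [BorelSpace ℚ_[p]]
  {Ω : Type*} [MeasurableSpace Ω] {P : Measure Ω}
  {ξ₁ ξ₂ : Ω → ℚ_[p]}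

theorem integral_character_linear_forms (hξ₁ : Measurable ξ₁) (hξ₂ : Measurable ξ₂)
    (hindep : IndepFun ξ₁ ξ₂ P) (a s t : ℚ_[p]) (y : CharGroup ℚ_[p]) :
    ∫ ω, ((y (Multiplicative.ofAdd (s * (ξ₁ ω + ξ₂ ω) + t * (ξ₁ ω + a * ξ₂ ω))) : Circle) : ℂ) ∂P =
      charFn (P.map ξ₁) (dilate (s + t) y) * charFn (P.map ξ₂) (dilate (s + a * t) y) := by
  have hc := continuous_character (dilate (s + t) y)
  have hc' := continuous_character (dilate (s + a * t) y)
  have hprod := (hindep.comp hc.measurable hc'.measurable).integral_fun_mul_eq_mul_integral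
    (hc.measurable.comp hξ₁).aestronglyMeasurable (hc'.measurable.comp hξ₂).aestronglyMeasurable
  unfold charFn
  rw [integral_map hξ₁.aemeasurable hc.aestronglyMeasurable,
    integral_map hξ₂.aemeasurable hc'.aestronglyMeasurable]
  refine Eq.trans (integral_congr_ae (Eventually.of_forall fun ω => ?_)) hprod
  have hsplit : y (Multiplicative.ofAdd (s * (ξ₁ ω + ξ₂ ω) + t * (ξ₁ ω + a * ξ₂ ω))) =
      dilate (s + t) y (Multiplicative.ofAdd (ξ₁ ω)) *
        dilate (s + a * t) y (Multiplicative.ofAdd (ξ₂ ω)) := by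
    rw [dilate_apply, dilate_apply, ← map_mul, ← ofAdd_add]
    congr 2
    ring
  exact (congrArg ((↑) : Circle → ℂ) hsplit).trans (Circle.coe_mul _ _)

variable [IsProbabilityMeasure P]

/-- The joint law is the law of `L₁` composed with the conditional kernel, and symmetry leaves that
kernel unchanged almost everywhere. -/
theorem map_prod_neg_eq_of_symmetric {L₁ L₂ : Ω → ℚ_[p]}
    (h₂ : Measurable L₂) (hsymm : CondDistribSymmetric L₂ L₁ P) :
    P.map (fun ω => (L₁ ω, -L₂ ω)) = P.map (fun ω => (L₁ ω, L₂ ω)) := by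
  have hneg : Measurable fun z : ℚ_[p] => -z := measurable_neg
  have h : condDistrib ((fun z => -z) ∘ L₂) L₁ P =ᵐ[P.map L₁] condDistrib L₂ L₁ P := by
    filter_upwards [condDistrib_comp (μ := P) L₁ h₂.aemeasurable hneg, hsymm] with x hx hx'
    rw [hx, Kernel.map_apply _ hneg, hx']
  have h3 := Measure.compProd_congr h
  rw [compProd_map_condDistrib (hneg.comp h₂).aemeasurable,
    compProd_map_condDistrib h₂.aemeasurable] at h3
  exact h3

theorem charFn_mul_charFn_eq (hξ₁ : Measurable ξ₁) (hξ₂ : Measurable ξ₂)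
    (hindep : IndepFun ξ₁ ξ₂ P) {a : ℚ_[p]}
    (hsymm : CondDistribSymmetric (fun ω => ξ₁ ω + a * ξ₂ ω) (fun ω => ξ₁ ω + ξ₂ ω) P)
    (s t : ℚ_[p]) (y : CharGroup ℚ_[p]) :
    charFn (P.map ξ₁) (dilate (s + t) y) * charFn (P.map ξ₂) (dilate (s + a * t) y) =
      charFn (P.map ξ₁) (dilate (s - t) y) * charFn (P.map ξ₂) (dilate (s - a * t) y) := by
  have h₁ : Measurable fun ω => ξ₁ ω + ξ₂ ω := hξ₁.add hξ₂
  have h₂ : Measurable fun ω => ξ₁ ω + a * ξ₂ ω := hξ₁.add (hξ₂.const_mul a)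
  have h₂' : Measurable fun ω => -(ξ₁ ω + a * ξ₂ ω) := h₂.neg
  have hlaw := map_prod_neg_eq_of_symmetric h₂ hsymm
  have hc : Continuous fun q : ℚ_[p] × ℚ_[p] =>
      ((y (Multiplicative.ofAdd (s * q.1 + t * q.2)) : Circle) : ℂ) :=
    (continuous_character y).comp (by fun_prop)
  have h := congrArg (fun ν => ∫ q : ℚ_[p] × ℚ_[p],
      ((y (Multiplicative.ofAdd (s * q.1 + t * q.2)) : Circle) : ℂ) ∂ν) hlaw
  beta_reduce at h
  rw [integral_map (h₁.prodMk h₂').aemeasurable hc.aestronglyMeasurable,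
    integral_map (h₁.prodMk h₂).aemeasurable hc.aestronglyMeasurable,
    integral_character_linear_forms hξ₁ hξ₂ hindep] at h
  rw [← h, sub_eq_add_neg s t, sub_eq_add_neg s (a * t), ← mul_neg a t,
    ← integral_character_linear_forms hξ₁ hξ₂ hindep]
  exact integral_congr_ae (Eventually.of_forall fun ω =>
    congrArg (fun z => ((y (Multiplicative.ofAdd z) : Circle) : ℂ)) (by ring))

theorem modulusEquation_charFn (hξ₁ : Measurable ξ₁) (hξ₂ : Measurable ξ₂)
    (hindep : IndepFun ξ₁ ξ₂ P) {a : ℚ_[p]}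
    (hsymm : CondDistribSymmetric (fun ω => ξ₁ ω + a * ξ₂ ω) (fun ω => ξ₁ ω + ξ₂ ω) P)
    (y : CharGroup ℚ_[p]) :
    ModulusEquation a (fun t => ‖charFn (P.map ξ₁) (dilate t y)‖)
      (fun t => ‖charFn (P.map ξ₂) (dilate t y)‖) := by
  have := Measure.isProbabilityMeasure_map (μ := P) hξ₁.aemeasurable
  have := Measure.isProbabilityMeasure_map (μ := P) hξ₂.aemeasurable
  refine ⟨(continuous_charFn_dilate _ y).norm, (continuous_charFn_dilate _ y).norm,
    fun _ => norm_nonneg _, fun _ => norm_nonneg _, fun _ => norm_charFn_le_one _ _,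
    fun _ => norm_charFn_le_one _ _, ?_, ?_, fun x => ?_, fun x => ?_, fun s t => ?_⟩
  · simp only [dilate_zero, charFn_one, norm_one]
  · simp only [dilate_zero, charFn_one, norm_one]
  · simp only [dilate_neg, norm_charFn_inv]
  · simp only [dilate_neg, norm_charFn_inv]
  · simp only [← norm_mul, charFn_mul_charFn_eq hξ₁ hξ₂ hindep hsymm s t y]

/-- If, for every `r > 0`, one of the characteristic functions is nonzero somewhere outside the
annihilator of the ball of radius `r`, then both distributions are degenerate. -/
theorem isDegenerate_and_of_forall_exists_ne_zero (hξ₁ : Measurable ξ₁) (hξ₂ : Measurable ξ₂)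
    (hindep : IndepFun ξ₁ ξ₂ P) {a : ℚ_[p]} (ha0 : a ≠ 0) (ha : a ≠ -1)
    (hsymm : CondDistribSymmetric (fun ω => ξ₁ ω + a * ξ₂ ω) (fun ω => ξ₁ ω + ξ₂ ω) P)
    (hsupp : ∀ r : ℝ, 0 < r → ∃ y ∉ ballAnnihilator p r,
      charFn (P.map ξ₁) y ≠ 0 ∨ charFn (P.map ξ₂) y ≠ 0) :
    IsDegenerate (P.map ξ₁) ∧ IsDegenerate (P.map ξ₂) := by
  have := Measure.isProbabilityMeasure_map (μ := P) hξ₁.aemeasurable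
  have := Measure.isProbabilityMeasure_map (μ := P) hξ₂.aemeasurable
  have hH := modulusEquation_charFn hξ₁ hξ₂ hindep hsymm
  obtain ⟨e, e', he, he', hmult⟩ := ModulusEquation.exists_multiplier ha0 ha
  have hone : ∀ r : ℝ, 0 < r → ∃ y ∉ ballAnnihilator p r,
      ‖charFn (P.map ξ₁) y‖ = 1 ∨ ‖charFn (P.map ξ₂) y‖ = 1 := by
    intro r hr
    -- The minimum allows either multiplier: dilation by `e` turns radius `‖e‖ * r` into `r`, and
    -- likewise for `e'`.
    obtain ⟨y, hy, hne⟩ := hsupp (min (‖e‖ * r) (‖e'‖ * r))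
      (lt_min (mul_pos (norm_pos_iff.2 he) hr) (mul_pos (norm_pos_iff.2 he') hr))
    have hy₁ : y ∉ ballAnnihilator p (‖e‖ * r) :=
      fun h => hy (ballAnnihilator_anti (min_le_left _ _) h)
    have hy₂ : y ∉ ballAnnihilator p (‖e'‖ * r) :=
      fun h => hy (ballAnnihilator_anti (min_le_right _ _) h)
    have hm := hmult _ _ (hH y) 1
    simp only [mul_one, dilate_one, norm_ne_zero_iff] at hm
    rcases hne with hne | hne
    · exact ⟨_, dilate_notMem he hy₁, hm.1 hne⟩
    · exact ⟨_, dilate_notMem he' hy₂, hm.2 hne⟩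
  -- Annihilators grow as the radius shrinks, so failure for both measures, at `r₁` and `r₂`, would
  -- contradict `hone` at the smaller radius.
  have hcases : (∀ r : ℝ, 0 < r → ∃ y ∉ ballAnnihilator p r, ‖charFn (P.map ξ₁) y‖ = 1) ∨
      (∀ r : ℝ, 0 < r → ∃ y ∉ ballAnnihilator p r, ‖charFn (P.map ξ₂) y‖ = 1) := by
    by_contra! hcon
    obtain ⟨⟨r₁, hr₁, h₁⟩, r₂, hr₂, h₂⟩ := hcon
    obtain ⟨y, hy, hy'⟩ := hone (min r₁ r₂) (lt_min hr₁ hr₂)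
    rcases hy' with hy' | hy'
    · exact h₁ y (fun h => hy (ballAnnihilator_anti (min_le_left _ _) h)) hy'
    · exact h₂ y (fun h => hy (ballAnnihilator_anti (min_le_right _ _) h)) hy'
  rcases hcases with h | h
  · have hdeg := isDegenerate_of_norm_charFn h
    refine ⟨hdeg, isDegenerate_of_norm_charFn fun r hr => ?_⟩
    obtain ⟨x, hx⟩ := hdeg
    obtain ⟨y, hy⟩ := exists_notMem_ballAnnihilator (p := p) hr
    -- Once the first law is a point mass, its modulus is `1` on every orbit, and the equation
    -- passes this to the second.
    have := (hH y).right_eq_one ha0 (fun t => by rw [hx, norm_charFn_dirac]) 1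
    exact ⟨y, hy, by rwa [dilate_one] at this⟩
  · have hdeg := isDegenerate_of_norm_charFn h
    refine ⟨isDegenerate_of_norm_charFn fun r hr => ?_, hdeg⟩
    obtain ⟨x, hx⟩ := hdeg
    obtain ⟨y, hy⟩ := exists_notMem_ballAnnihilator (p := p) hr
    have := (hH y).left_eq_one (fun t => by rw [hx, norm_charFn_dirac]) 1
    exact ⟨y, hy, by rwa [dilate_one] at this⟩

end Heyde

end PadicHeyde

theorem proposition1 (p : ℕ) [Fact p.Prime] [MeasurableSpace ℚ_[p]] [BorelSpace ℚ_[p]]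
    {Ω : Type*} [MeasurableSpace Ω] (P : Measure Ω) [IsProbabilityMeasure P]
    (ξ₁ ξ₂ : Ω → ℚ_[p]) (hξ₁ : Measurable ξ₁) (hξ₂ : Measurable ξ₂)
    (hindep : IndepFun ξ₁ ξ₂ P)
    (α : ℚ_[p] ≃ₜ+ ℚ_[p]) (hα : ¬ ∀ x : ℚ_[p], α x = -x)
    (hsymm : CondDistribSymmetric (fun ω => ξ₁ ω + α (ξ₂ ω)) (fun ω => ξ₁ ω + ξ₂ ω) P) :
    (IsDegenerate (P.map ξ₁) ∧ IsDegenerate (P.map ξ₂)) ∨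
      ∃ M : Subgroup (CharGroup ℚ_[p]), IsClosed (M : Set (CharGroup ℚ_[p])) ∧ M ≠ ⊤ ∧
        ∀ y : CharGroup ℚ_[p], y ∉ M →
          charFn (P.map ξ₁) y = 0 ∧ charFn (P.map ξ₂) y = 0 := by
  have hmul := PadicHeyde.apply_eq_mul_apply_one α
  have ha0 : α 1 ≠ 0 := fun h => one_ne_zero (α.injective (h.trans (map_zero α).symm))
  have ha : α 1 ≠ -1 := fun h => hα fun x => by rw [hmul, h, neg_one_mul]
  have hsymm' : CondDistribSymmetric (fun ω => ξ₁ ω + α 1 * ξ₂ ω) (fun ω => ξ₁ ω + ξ₂ ω) P := by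
    simpa only [← hmul] using hsymm
  by_cases hsupp : ∀ r : ℝ, 0 < r → ∃ y ∉ PadicHeyde.ballAnnihilator p r,
      charFn (P.map ξ₁) y ≠ 0 ∨ charFn (P.map ξ₂) y ≠ 0
  · exact Or.inl (PadicHeyde.isDegenerate_and_of_forall_exists_ne_zero hξ₁ hξ₂ hindep ha0 ha
      hsymm' hsupp)
  · push Not at hsupp
    obtain ⟨r, hr, h⟩ := hsupp
    exact Or.inr ⟨PadicHeyde.ballAnnihilator p r, PadicHeyde.isClosed_ballAnnihilator r,
      PadicHeyde.ballAnnihilator_ne_top hr, h⟩
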